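/- Let $m>0$, let $v\in\mathbb R^3$ with $|v|<1$, and let $\rho:\mathbb R^3\to\mathbb R$ be a real-valued, compactly supported, spherically symmetric function of the Sobolev class $H^2(\mathbb R^3)$. Let $\psi_v\in H^1(\mathbb R^3)$ be the unique solution of $[-\Delta+m^2+(v\cdot\nabla)^2]\psi_v=-\rho$, and let $B_v=\sqrt{1-v^2}\,(E-v\otimes v)$, where $E$ is the $3\times3$ identity matrix. Let $\mathcal E=H^1(\mathbb R^3)\oplus L^2(\mathbb R^3)\oplus\mathbb C^3\oplus\mathbb C^3$ (complex-valued functions) be the phase space of states $X=(\Psi,\Pi,Q,P)$, with the norm $\|\nabla\Psi\|_{L^2}+\|\Psi\|_{L^2}+\|\Pi\|_{L^2}+|Q|+|P|$, and let $\mathcal E^+=H^2(\mathbb R^3)\oplus H^1(\mathbb R^3)\oplus\mathbb C^3\oplus\mathbb C^3$. Consider the operator (the linearization at the soliton with velocity $v$ of the Klein-Gordon field coupled to a relativistic particle) $$A_{v,v}\begin{pmatrix}\Psi\\ \Pi\\ Q\\ P\end{pmatrix}=\begin{pmatrix}\Pi+v\cdot\nabla\Psi\\ \Delta\Psi-m^2\Psi+v\cdot\nabla\Pi+Q\cdot\nabla\rho\\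 B_vP\\ -\langle\nabla\Psi,\rho\rangle+\langle\nabla\psi_v,Q\cdot\nabla\rho\rangle\end{pmatrix},\qquad \langle f,g\rangle=\int_{\mathbb R^3} f(x)g(x)\,dx,$$ in $\mathcal E$, with the derivatives in the sense of distributions, on the domain of all $X\in\mathcal E$ with $A_{v,v}X\in\mathcal E$. Then for every $\lambda\in\mathbb C$ with $\operatorname{Re}\lambda>0$ the operator $A_{v,v}-\lambda$ is a bijection of its domain onto $\mathcal E$, and its inverse, the resolvent $R(\lambda)=(A_{v,v}-\lambda)^{-1}$, is a bounded operator $\mathcal E\to\mathcal E$ with range in $\mathcal E^+$. The operator-valued function $\lambda\mapsto R(\lambda)$ is analytic, in the operator norm, in the half-plane $\operatorname{Re}\lambda>0$. -/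

import Mathlib

noncomputable section

namespace KGParticle

open MeasureTheory TemperedDistribution
open scoped SchwartzMap LineDeriv Laplacian

/-- The physical space `ℝ³` with its Euclidean norm. -/
abbrev R3 := EuclideanSpace ℝ (Fin 3)

/-- Complexified particle coordinates. -/
abbrev C3 := EuclideanSpace ℂ (Fin 3)

/-- `L²(ℝ³; ℂ)`. -/
abbrev L2 := Lp ℂ 2 (volume : Measure R3)

/-- The standard basis vector `e_j` of `ℝ³`. -/
def e (j : Fin 3) : R3 := EuclideanSpace.single j 1

/-- The tempered distribution of an `L²` function, as a linear map. -/
def toDist : L2 →ₗ[ℂ] 𝓢'(R3, ℂ) :=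
  (Lp.toTemperedDistributionCLM ℂ (volume : Measure R3) 2).toLinearMap

theorem toDist_injective : Function.Injective toDist :=
  LinearMap.ker_eq_bot.mp
    (Lp.ker_toTemperedDistributionCLM_eq_bot (F := ℂ) (μ := (volume : Measure R3)) (p := 2))

/-- The pairs `(ψ, g)` with `ψ ∈ L²`, `g ∈ (L²)³` and `∇ψ = g` in the sense of distributions,
with the norm `‖ψ‖ + ‖g‖` of the sum `L² ⊕ (L²)³`. -/
def sobolevGraph : Submodule ℂ (WithLp 1 (L2 × PiLp 2 fun _ : Fin 3 => L2)) where
  carrier := {u | ∀ j, ∂_{e j} (toDist u.fst) = toDist (u.snd j)}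
  add_mem' {a b} ha hb j := by
    simp only [WithLp.add_fst, WithLp.add_snd, PiLp.add_apply, map_add,
      LineDeriv.lineDerivOp_add, ha j, hb j]
  zero_mem' j := by
    simp only [WithLp.zero_fst, WithLp.zero_snd, PiLp.zero_apply, map_zero,
      LineDeriv.lineDerivOp_zero]
  smul_mem' c a ha j := by
    simp only [WithLp.smul_fst, WithLp.smul_snd, PiLp.smul_apply, map_smul,
      LineDeriv.lineDerivOp_smul, ha j]

/-- The Sobolev space `H¹(ℝ³; ℂ)`: all `ψ ∈ L²` with a distributional gradient in `L²`.
An element is stored as the pair `(ψ, ∇ψ)`, so that its norm is `‖ψ‖_{L²} + ‖∇ψ‖_{L²}`. -/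
def H1 : Type := sobolevGraph

instance : NormedAddCommGroup H1 := inferInstanceAs (NormedAddCommGroup sobolevGraph)

instance : NormedSpace ℂ H1 := inferInstanceAs (NormedSpace ℂ sobolevGraph)

/-- The underlying `L²` function of an element of `H¹`. -/
def H1.fn : H1 →ₗ[ℂ] L2 where
  toFun u := WithLp.fst (Subtype.val u)
  map_add' _ _ := rfl
  map_smul' _ _ := rfl

/-- The weak partial derivative `∂_j` of an element of `H¹`. -/
def H1.grad (j : Fin 3) : H1 →ₗ[ℂ] L2 where
  toFun u := WithLp.snd (Subtype.val u) j
  map_add' _ _ := rfl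
  map_smul' _ _ := rfl

theorem H1.lineDeriv_fn (u : H1) (j : Fin 3) : ∂_{e j} (toDist (H1.fn u)) = toDist (H1.grad j u) :=
  Subtype.property u j

theorem H1.exists_of_lineDeriv (f : L2) (g : Fin 3 → L2)
    (h : ∀ j, ∂_{e j} (toDist f) = toDist (g j)) : ∃ u : H1, H1.fn u = f ∧ ∀ j, H1.grad j u = g j :=
  ⟨⟨WithLp.toLp 1 (f, WithLp.toLp 2 g), h⟩, rfl, fun _ => rfl⟩

theorem H1.fn_injective : Function.Injective H1.fn := by
  intro u w h
  have h2 : ∀ j, H1.grad j u = H1.grad j w := fun j =>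
    toDist_injective (by rw [← H1.lineDeriv_fn, ← H1.lineDeriv_fn, h])
  exact Subtype.ext (WithLp.ofLp_injective 1 (Prod.ext h (PiLp.ext h2)))

theorem H1.norm_eq (u : H1) :
    ‖u‖ = ‖H1.fn u‖ + Real.sqrt (∑ j, ‖H1.grad j u‖ ^ 2) := by
  have h1 : ∀ Y : WithLp 1 (L2 × PiLp 2 fun _ : Fin 3 => L2), ‖Y‖ = ‖Y.fst‖ + ‖Y.snd‖ :=
    WithLp.prod_norm_eq_of_L1
  have h2 : ∀ Y : PiLp 2 fun _ : Fin 3 => L2, ‖Y‖ = Real.sqrt (∑ j, ‖Y j‖ ^ 2) :=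
    PiLp.norm_eq_of_L2
  have h3 := h1 (Subtype.val u)
  rw [h2] at h3
  exact h3

/-- The (complexified) phase space `H¹ ⊕ L² ⊕ ℂ³ ⊕ ℂ³` of states `(Ψ, Π, Q, P)`, with the norm
`‖Ψ‖_{H¹} + ‖Π‖_{L²} + |Q| + |P|`. -/
def Energy : Type := WithLp 1 (H1 × WithLp 1 (L2 × WithLp 1 (C3 × C3)))

instance : NormedAddCommGroup Energy :=
  inferInstanceAs (NormedAddCommGroup (WithLp 1 (H1 × WithLp 1 (L2 × WithLp 1 (C3 × C3)))))

instance : NormedSpace ℂ Energy :=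
  inferInstanceAs (NormedSpace ℂ (WithLp 1 (H1 × WithLp 1 (L2 × WithLp 1 (C3 × C3)))))

/-- The state with the components `(Ψ, Π, Q, P)`. -/
def state (u : H1) (p : L2) (a b : C3) : Energy :=
  WithLp.toLp 1 (u, WithLp.toLp 1 (p, WithLp.toLp 1 (a, b)))

/-- The component `Ψ` of a state. -/
def psi : Energy →ₗ[ℂ] H1 where
  toFun X := WithLp.fst X
  map_add' _ _ := rfl
  map_smul' _ _ := rfl

/-- The component `Π` of a state. -/
def mom : Energy →ₗ[ℂ] L2 where
  toFun X := WithLp.fst (WithLp.snd X)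
  map_add' _ _ := rfl
  map_smul' _ _ := rfl

/-- The component `Q` of a state. -/
def pos : Energy →ₗ[ℂ] C3 where
  toFun X := WithLp.fst (WithLp.snd (WithLp.snd X))
  map_add' _ _ := rfl
  map_smul' _ _ := rfl

/-- The component `P` of a state. -/
def imp : Energy →ₗ[ℂ] C3 where
  toFun X := WithLp.snd (WithLp.snd (WithLp.snd X))
  map_add' _ _ := rfl
  map_smul' _ _ := rfl

theorem state_eta (X : Energy) : state (psi X) (mom X) (pos X) (imp X) = X := rfl

theorem Energy.ext {X Y : Energy} (h1 : psi X = psi Y) (h2 : mom X = mom Y)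
    (h3 : pos X = pos Y) (h4 : imp X = imp Y) : X = Y := by
  rw [← state_eta X, ← state_eta Y, h1, h2, h3, h4]

theorem Energy.norm_eq (X : Energy) :
    ‖X‖ = ‖psi X‖ + (‖mom X‖ + (‖pos X‖ + ‖imp X‖)) := by
  have h1 : ∀ Y : WithLp 1 (C3 × C3), ‖Y‖ = ‖Y.fst‖ + ‖Y.snd‖ := WithLp.prod_norm_eq_of_L1
  have h2 : ∀ Y : WithLp 1 (L2 × WithLp 1 (C3 × C3)), ‖Y‖ = ‖Y.fst‖ + ‖Y.snd‖ :=
    WithLp.prod_norm_eq_of_L1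
  have h3 : ∀ Y : WithLp 1 (H1 × WithLp 1 (L2 × WithLp 1 (C3 × C3))),
      ‖Y‖ = ‖Y.fst‖ + ‖Y.snd‖ := WithLp.prod_norm_eq_of_L1
  have h4 := h3 X
  rw [h2, h1] at h4
  exact h4

/-- The subspace `H² ⊕ H¹ ⊕ ℂ³ ⊕ ℂ³` of the phase space. -/
def EnergyPlus : Set Energy :=
  {X | MemSobolev 2 2 (toDist (H1.fn (psi X))) ∧ MemSobolev 1 2 (toDist (mom X))}

/-- Charge densities: real-valued functions of Sobolev class `H²(ℝ³)` that are compactly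
supported and spherically symmetric. -/
structure ChargeDensity where
  /-- the density itself -/
  toFun : R3 → ℝ
  memLp : MemLp (fun x => (toFun x : ℂ)) 2 (volume : Measure R3)
  memSobolev : MemSobolev 2 2 (toDist (memLp.toLp _))
  compactSupport : ∃ r : ℝ, ∀ x, r ≤ ‖x‖ → toFun x = 0
  radial : ∃ ρ₁ : ℝ → ℝ, ∀ x, toFun x = ρ₁ ‖x‖

namespace ChargeDensity

/-- The density as an element of `L²(ℝ³; ℂ)`. -/
def toL2 (ρ : ChargeDensity) : L2 := ρ.memLp.toLp _

theorem exists_partial (ρ : ChargeDensity) (j : Fin 3) :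
    ∃ g : L2, ∂_{e j} (toDist ρ.toL2) = toDist g := by
  have h : MemSobolev (2 - 1) 2 (∂_{e j} (toDist ρ.toL2)) := ρ.memSobolev.lineDerivOp
  exact memSobolev_zero_iff.mp (h.mono (by norm_num))

/-- The weak partial derivative `∂_j ρ ∈ L²` (unique, since `toDist` is injective). -/
def partialDeriv (ρ : ChargeDensity) (j : Fin 3) : L2 := (ρ.exists_partial j).choose

theorem lineDeriv_toL2 (ρ : ChargeDensity) (j : Fin 3) :
    ∂_{e j} (toDist ρ.toL2) = toDist (ρ.partialDeriv j) :=
  (ρ.exists_partial j).choose_spec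

end ChargeDensity

/-- The soliton field equation `Λψ = [-Δ + m² + (v·∇)²]ψ = -ρ`, in the sense of distributions. -/
def IsSolitonField (m : ℝ) (ρ : ChargeDensity) (v : R3) (ψ : H1) : Prop :=
  -Δ (toDist (H1.fn ψ)) + toDist ((m : ℂ) ^ 2 • H1.fn ψ) + ∂_{v} (∂_{v} (toDist (H1.fn ψ)))
    = -toDist ρ.toL2

open Classical in
/-- The soliton field `ψ_v = -Λ⁻¹ρ`. For `m > 0` and `|v| < 1` the symbol
`k² + m² - (v·k)²` of `Λ` is bounded below by a positive multiple of `1 + k²`, so that the field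
equation has exactly one solution; the value `0` is used only when there is no solution. -/
def solitonField (m : ℝ) (ρ : ChargeDensity) (v : R3) : H1 :=
  if h : ∃ ψ : H1, IsSolitonField m ρ v ψ then h.choose else 0

/-- The matrix `B_v = ν (E - v ⊗ v)` with `ν = √(1 - v²)`, acting on `ℂ³`. -/
def velocityMap (v : R3) : C3 →ₗ[ℂ] C3 :=
  Matrix.toEuclideanLin (Matrix.of fun i j : Fin 3 =>
    ((Real.sqrt (1 - ‖v‖ ^ 2) * ((if i = j then 1 else 0) - v i * v j) : ℝ) : ℂ))

/-- The `Ψ`-component `Π + w·∇Ψ` of `A_{v,w} X`, as a distribution. -/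
def psiRow (w : R3) : Energy →ₗ[ℂ] 𝓢'(R3, ℂ) where
  toFun X := toDist (mom X) + ∂_{w} (toDist (H1.fn (psi X)))
  map_add' X Y := by
    simp only [map_add, LineDeriv.lineDerivOp_add]
    abel
  map_smul' c X := by
    simp only [map_smul, LineDeriv.lineDerivOp_smul, smul_add, RingHom.id_apply]

/-- The function `Q·∇ρ ∈ L²`. -/
def directionalDeriv (ρ : ChargeDensity) : C3 →ₗ[ℂ] L2 where
  toFun q := ∑ j, q j • ρ.partialDeriv j
  map_add' p q := by simp only [PiLp.add_apply, add_smul, Finset.sum_add_distrib]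
  map_smul' c q := by
    simp only [PiLp.smul_apply, smul_assoc, Finset.smul_sum, RingHom.id_apply]

/-- The `Π`-component `ΔΨ - m²Ψ + w·∇Π + Q·∇ρ` of `A_{v,w} X`, as a distribution. -/
def momRow (m : ℝ) (ρ : ChargeDensity) (w : R3) : Energy →ₗ[ℂ] 𝓢'(R3, ℂ) where
  toFun X := Δ (toDist (H1.fn (psi X))) - toDist ((m : ℂ) ^ 2 • H1.fn (psi X))
    + ∂_{w} (toDist (mom X)) + toDist (directionalDeriv ρ (pos X))
  map_add' X Y := by
    simp only [← laplacianCLM_apply, map_add, LineDeriv.lineDerivOp_add, smul_add]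
    abel
  map_smul' c X := by
    simp only [← laplacianCLM_apply, map_smul, LineDeriv.lineDerivOp_smul, smul_add, smul_sub,
      RingHom.id_apply, smul_comm c ((m : ℂ) ^ 2)]

/-- The `P`-component `-⟨∇Ψ, ρ⟩ + ⟨∇ψ_v, Q·∇ρ⟩` of `A_{v,w} X`, where
`⟨∂_i ψ_v, Q·∇ρ⟩ = ∑ j, ⟨∂_i ψ_v, ∂_j ρ⟩ Q_j`. As `ρ` and `∂_j ρ` are real-valued, the `L²` inner
products below (antilinear in the first entry) are the integrals of the products. -/
def impRow (m : ℝ) (ρ : ChargeDensity) (v : R3) : Energy →ₗ[ℂ] C3 where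
  toFun X := WithLp.toLp 2 fun i : Fin 3 => -inner ℂ ρ.toL2 (H1.grad i (psi X))
    + ∑ j, inner ℂ (ρ.partialDeriv j) (H1.grad i (solitonField m ρ v)) * pos X j
  map_add' X Y := by
    ext i
    simp only [map_add, PiLp.add_apply, inner_add_right, mul_add, Finset.sum_add_distrib]
    ring
  map_smul' c X := by
    ext i
    simp only [map_smul, PiLp.smul_apply, inner_smul_right, smul_eq_mul, mul_add, Finset.mul_sum,
      mul_neg, mul_left_comm c, RingHom.id_apply]

/-- The graph of the linearized operator `A_{v,w}`: the pairs of states `(X, Y)` such that `Y`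
has, in the sense of distributions, the components
`Π + w·∇Ψ`, `ΔΨ - m²Ψ + w·∇Π + Q·∇ρ`, `B_v P`, `-⟨∇Ψ, ρ⟩ + ⟨∇ψ_v, Q·∇ρ⟩`,
where `X = (Ψ, Π, Q, P)`. -/
def linearizedGraph (m : ℝ) (ρ : ChargeDensity) (v w : R3) : Submodule ℂ (Energy × Energy) where
  carrier := {Z |
    toDist (H1.fn (psi Z.2)) = psiRow w Z.1 ∧
    toDist (mom Z.2) = momRow m ρ w Z.1 ∧
    pos Z.2 = velocityMap v (imp Z.1) ∧
    imp Z.2 = impRow m ρ v Z.1}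
  add_mem' {a b} ha hb := by
    obtain ⟨a1, a2, a3, a4⟩ := ha
    obtain ⟨b1, b2, b3, b4⟩ := hb
    refine ⟨?_, ?_, ?_, ?_⟩
    · simp only [Prod.fst_add, Prod.snd_add, map_add, a1, b1]
    · simp only [Prod.fst_add, Prod.snd_add, map_add, a2, b2]
    · simp only [Prod.fst_add, Prod.snd_add, map_add, a3, b3]
    · simp only [Prod.fst_add, Prod.snd_add, map_add, a4, b4]
  zero_mem' := by
    refine ⟨?_, ?_, ?_, ?_⟩ <;> simp only [Prod.fst_zero, Prod.snd_zero, map_zero]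
  smul_mem' c a ha := by
    obtain ⟨a1, a2, a3, a4⟩ := ha
    refine ⟨?_, ?_, ?_, ?_⟩
    · simp only [Prod.smul_fst, Prod.smul_snd, map_smul, a1]
    · simp only [Prod.smul_fst, Prod.smul_snd, map_smul, a2]
    · simp only [Prod.smul_fst, Prod.smul_snd, map_smul, a3]
    · simp only [Prod.smul_fst, Prod.smul_snd, map_smul, a4]

/-- The linearized operator `A_{v,w}` as an unbounded operator on the phase space, on its maximal
domain: the states `X` for which `A_{v,w} X`, computed in the sense of distributions, lies in the
phase space. -/
def linearizedOp (m : ℝ) (ρ : ChargeDensity) (v w : R3) : Energy →ₗ.[ℂ] Energy :=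
  (linearizedGraph m ρ v w).toLinearPMap

theorem linearizedGraph_single_valued (m : ℝ) (ρ : ChargeDensity) (v w : R3)
    (Z : Energy × Energy) (hZ : Z ∈ linearizedGraph m ρ v w) (h0 : Z.1 = 0) : Z.2 = 0 := by
  obtain ⟨h1, h2, h3, h4⟩ := hZ
  simp only [h0, map_zero] at h1 h2 h3 h4
  exact Energy.ext (H1.fn_injective (toDist_injective (by simpa only [map_zero] using h1)))
    (toDist_injective (by simpa only [map_zero] using h2)) (by simpa only [map_zero] using h3)
    (by simpa only [map_zero] using h4)

/-- `linearizedOp` really has the graph `linearizedGraph`. -/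
theorem linearizedOp_graph (m : ℝ) (ρ : ChargeDensity) (v w : R3) :
    (linearizedOp m ρ v w).graph = linearizedGraph m ρ v w :=
  Submodule.toLinearPMap_graph_eq _ (linearizedGraph_single_valued m ρ v w)

/-- The bounded operator `R` is the inverse of `A - z : D(A) → 𝓔`. -/
def IsResolventAt (A : Energy →ₗ.[ℂ] Energy) (z : ℂ) (R : Energy →L[ℂ] Energy) : Prop :=
  (∀ Y : Energy, ∃ h : R Y ∈ A.domain, A ⟨R Y, h⟩ - z • R Y = Y) ∧
  ∀ X : A.domain, R (A X - z • (X : Energy)) = X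

end KGParticle

end

/-!
# The resolvent of the linearized Klein-Gordon-particle system

On the Fourier side the field equation of the resolvent problem is a division by a symbol. The
first row of `(A - z) X = Y` determines `Π`; inserting it into the second row leaves
`[-Δ + m² + (z - v·∇)²] Ψ = Q·∇ρ + (data)` (`mem_linearizedGraph_iff`), whose symbol
`D_z(k) = m² + |2πk|² + (z - 2πi k·v)²` factorizes into two factors that are bounded below by a
multiple of `1 + |k|` when `Re z > 0` and `|v| < 1` (`exists_le_norm_kgSymbol`). Hence `Ψ` exists
in `H²` and depends linearly on `Q` and the data, and a `6 × 6` linear system for `(Q, P)` remains.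

This system is solvable as soon as it is injective, that is, as soon as `z` is not an eigenvalue.
For an eigenvector with `g = Q·∇ρ` the last row reads
`⟨Q, P⟩ = ∫ |ĝ|² z⁻¹ (1 / D_z - 1 / D_0)`, where the term with `D_0 > 0` comes from the soliton
field. As `D_z = D_0 + z μ` with `Re μ > 0`, the integrand has a nonpositive real part
(`re_inner_nonpos`). But the third row `z Q = B_v P` gives `⟨Q, P⟩ = ⟨B_v P, P⟩ / z̄`, whose real
part is positive for `P ≠ 0` because `B_v` is positive definite. So `P = 0`, and then everything
else vanishes (`eq_zero_of_mem_linearizedGraph`).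

Boundedness of the inverse comes from the closed graph theorem, as the phase space is complete and
`A` is closed. Analyticity in the operator norm follows from the resolvent identity alone, since it
expresses `R(z)` as `R(w) (1 + (w - z) R(w))⁻¹` near `w`.
-/

noncomputable section

namespace KGParticle

open MeasureTheory TemperedDistribution Filter Topology
open scoped SchwartzMap LineDeriv Laplacian FourierTransform

/-! ### Inverting closed linear relations -/

/-- If the closed linear relation `G` is such that `G - z` is a bijection, then its inverse is
bounded, by the closed graph theorem. -/
theorem exists_continuous_inverse_of_isClosed {E : Type*} [NormedAddCommGroup E] [NormedSpace ℂ E]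
    [CompleteSpace E] (G : Submodule ℂ (E × E)) (hG : IsClosed (G : Set (E × E))) (z : ℂ)
    (hsurj : ∀ Y, ∃ X, (X, Y + z • X) ∈ G) (hinj : ∀ X, (X, z • X) ∈ G → X = 0) :
    ∃ R : E →L[ℂ] E, ∀ X Y, R Y = X ↔ (X, Y + z • X) ∈ G := by
  choose f hf using hsurj
  have huniq : ∀ X Y, (X, Y + z • X) ∈ G → f Y = X := by
    intro X Y h
    have h1 := G.sub_mem (hf Y) h
    rw [Prod.mk_sub_mk, add_sub_add_left_eq_sub, ← smul_sub] at h1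
    exact sub_eq_zero.mp (hinj _ h1)
  let L : E →ₗ[ℂ] E :=
    { toFun := f
      map_add' := fun x y => huniq _ _ (by
        have h1 := G.add_mem (hf x) (hf y)
        rw [Prod.mk_add_mk] at h1
        rwa [smul_add, add_add_add_comm])
      map_smul' := fun c x => huniq _ _ (by
        have h1 := G.smul_mem c (hf x)
        rw [Prod.smul_mk, smul_add, smul_comm c z] at h1
        exact h1) }
  have hset : (L.graph : Set (E × E)) = (fun q : E × E => (q.2, q.1 + z • q.2)) ⁻¹' G := by
    ext q
    rw [SetLike.mem_coe, LinearMap.mem_graph_iff, Set.mem_preimage, SetLike.mem_coe]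
    constructor
    · intro h
      rw [h]
      exact hf q.1
    · intro h
      exact (huniq _ _ h).symm
  have hcl : IsClosed (L.graph : Set (E × E)) := by
    rw [hset]
    exact hG.preimage (by fun_prop)
  refine ⟨ContinuousLinearMap.ofIsClosedGraph hcl, fun X Y => ?_⟩
  constructor
  · rintro rfl
    exact hf Y
  · intro h
    exact huniq X Y h

/-- Near `w` the identity reads `R z = R w (1 + (w - z) R w)⁻¹`, and inversion is analytic on the
units of the Banach algebra of bounded operators; no separate continuity of `R` is needed. -/
theorem analyticOnNhd_of_resolvent_identity {E : Type*} [NormedAddCommGroup E] [NormedSpace ℂ E]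
    [CompleteSpace E] (R : ℂ → (E →L[ℂ] E)) (U : Set ℂ) (hU : IsOpen U)
    (h : ∀ z ∈ U, ∀ w ∈ U, R z * (1 + (w - z) • R w) = R w) : AnalyticOnNhd ℂ R U := by
  intro w hw
  have hc : AnalyticAt ℂ (fun z : ℂ => (1 : E →L[ℂ] E) + (w - z) • R w) w := by
    fun_prop
  have hw1 : (1 : E →L[ℂ] E) + (w - w) • R w = ((1 : (E →L[ℂ] E)ˣ) : E →L[ℂ] E) := by simp
  have hinv : AnalyticAt ℂ (fun z : ℂ => Ring.inverse ((1 : E →L[ℂ] E) + (w - z) • R w)) w := by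
    refine AnalyticAt.fun_comp (g := Ring.inverse) ?_ hc
    rw [hw1]
    exact analyticAt_inverse _
  refine AnalyticAt.congr (analyticAt_const.mul hinv : AnalyticAt ℂ (fun z : ℂ =>
    R w * Ring.inverse ((1 : E →L[ℂ] E) + (w - z) • R w)) w) ?_
  have hu : ∀ᶠ z in 𝓝 w, IsUnit ((1 : E →L[ℂ] E) + (w - z) • R w) := by
    refine hc.continuousAt.eventually (Units.isOpen.mem_nhds ?_)
    simp
  filter_upwards [hu, hU.mem_nhds hw] with z hz hzU
  have h1 := Ring.mul_inverse_cancel_right _ (R z) hz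
  rwa [h z hzU w hw] at h1

/-! ### The phase space is complete and the linearized operator is closed -/

theorem continuous_toDist : Continuous toDist :=
  (Lp.toTemperedDistributionCLM ℂ (volume : Measure R3) 2).continuous

theorem isClosed_sobolevGraph :
    IsClosed (sobolevGraph : Set (WithLp 1 (L2 × PiLp 2 fun _ : Fin 3 => L2))) := by
  have : (sobolevGraph : Set (WithLp 1 (L2 × PiLp 2 fun _ : Fin 3 => L2))) =
      ⋂ j, {u | LineDeriv.lineDerivOpCLM ℂ 𝓢'(R3, ℂ) (e j) (toDist u.fst) = toDist (u.snd j)} := by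
    ext u
    simp only [Set.mem_iInter]
    rfl
  rw [this]
  refine isClosed_iInter fun j => isClosed_eq ?_ ?_
  · exact (ContinuousLinearMap.continuous _).comp
      (continuous_toDist.comp (WithLp.continuous_fst 1 _ _))
  · exact continuous_toDist.comp
      ((PiLp.continuous_apply 2 (fun _ : Fin 3 => L2) j).comp (WithLp.continuous_snd 1 _ _))

instance : CompleteSpace H1 := isClosed_sobolevGraph.completeSpace_coe

instance : CompleteSpace Energy :=
  inferInstanceAs (CompleteSpace (WithLp 1 (H1 × WithLp 1 (L2 × WithLp 1 (C3 × C3)))))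

theorem continuous_fn : Continuous H1.fn :=
  (LinearMap.mkContinuous H1.fn 1 fun u => by
    rw [H1.norm_eq, one_mul]
    exact le_add_of_nonneg_right (Real.sqrt_nonneg _)).continuous

theorem continuous_grad (j : Fin 3) : Continuous (H1.grad j) :=
  (LinearMap.mkContinuous (H1.grad j) 1 fun u => by
    rw [H1.norm_eq, one_mul]
    refine le_add_of_nonneg_of_le (norm_nonneg _) (Real.le_sqrt_of_sq_le ?_)
    exact Finset.single_le_sum (f := fun j => ‖H1.grad j u‖ ^ 2) (fun i _ => sq_nonneg _)
      (Finset.mem_univ j)).continuous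

theorem continuous_psi : Continuous psi :=
  (LinearMap.mkContinuous psi 1 fun X => by
    rw [Energy.norm_eq, one_mul]
    exact le_add_of_nonneg_right (by positivity)).continuous

theorem continuous_mom : Continuous mom :=
  (LinearMap.mkContinuous mom 1 fun X => by
    rw [Energy.norm_eq, one_mul]
    linarith [norm_nonneg (psi X), norm_nonneg (pos X), norm_nonneg (imp X)]).continuous

theorem continuous_pos : Continuous pos :=
  (LinearMap.mkContinuous pos 1 fun X => by
    rw [Energy.norm_eq, one_mul]
    linarith [norm_nonneg (psi X), norm_nonneg (mom X), norm_nonneg (imp X)]).continuous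

theorem continuous_imp : Continuous imp :=
  (LinearMap.mkContinuous imp 1 fun X => by
    rw [Energy.norm_eq, one_mul]
    linarith [norm_nonneg (psi X), norm_nonneg (mom X), norm_nonneg (pos X)]).continuous

theorem continuous_psiRow (w : R3) : Continuous (psiRow w) := by
  refine (continuous_toDist.comp continuous_mom).add ?_
  exact (LineDeriv.lineDerivOpCLM ℂ 𝓢'(R3, ℂ) w).continuous.comp
    (continuous_toDist.comp (continuous_fn.comp continuous_psi))

theorem continuous_momRow (m : ℝ) (ρ : ChargeDensity) (w : R3) : Continuous (momRow m ρ w) := by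
  refine (((?_ : Continuous fun X : Energy => Δ (toDist (H1.fn (psi X)))).sub ?_).add ?_).add ?_
  · simp only [← laplacianCLM_apply]
    exact (ContinuousLinearMap.continuous _).comp
      (continuous_toDist.comp (continuous_fn.comp continuous_psi))
  · exact continuous_toDist.comp ((continuous_const_smul ((m : ℂ) ^ 2)).comp
      (continuous_fn.comp continuous_psi))
  · exact (LineDeriv.lineDerivOpCLM ℂ 𝓢'(R3, ℂ) w).continuous.comp
      (continuous_toDist.comp continuous_mom)
  · exact continuous_toDist.comp
      ((LinearMap.continuous_of_finiteDimensional _).comp continuous_pos)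

theorem continuous_impRow (m : ℝ) (ρ : ChargeDensity) (v : R3) : Continuous (impRow m ρ v) := by
  have hpos (j : Fin 3) : Continuous fun X : Energy => pos X j :=
    (PiLp.continuous_apply 2 _ j).comp continuous_pos
  have hg (j : Fin 3) : Continuous fun X : Energy => H1.grad j (psi X) :=
    (continuous_grad j).comp continuous_psi
  refine (PiLp.continuous_toLp 2 _).comp (continuous_pi fun i => ?_)
  exact (continuous_const.inner (hg i)).neg.add
    (continuous_finsetSum _ fun j _ => continuous_const.mul (hpos j))

theorem isClosed_linearizedGraph (m : ℝ) (ρ : ChargeDensity) (v w : R3) :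
    IsClosed (linearizedGraph m ρ v w : Set (Energy × Energy)) := by
  refine (isClosed_eq ?_ ?_).inter ((isClosed_eq ?_ ?_).inter ((isClosed_eq ?_ ?_).inter
    (isClosed_eq ?_ ?_)))
  · exact continuous_toDist.comp (continuous_fn.comp (continuous_psi.comp continuous_snd))
  · exact (continuous_psiRow w).comp continuous_fst
  · exact continuous_toDist.comp (continuous_mom.comp continuous_snd)
  · exact (continuous_momRow m ρ w).comp continuous_fst
  · exact continuous_pos.comp continuous_snd
  · exact (LinearMap.continuous_of_finiteDimensional _).comp (continuous_imp.comp continuous_fst)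
  · exact continuous_imp.comp continuous_snd
  · exact (continuous_impRow m ρ v).comp continuous_fst

/-- The resolvent of `A_{v,w}` is characterized by the graph of `A_{v,w}`. -/
theorem isResolventAt_of_mem_graph {m : ℝ} {ρ : ChargeDensity} {v w : R3} {z : ℂ}
    {R : Energy →L[ℂ] Energy}
    (h : ∀ X Y, R Y = X ↔ (X, Y + z • X) ∈ linearizedGraph m ρ v w) :
    IsResolventAt (linearizedOp m ρ v w) z R := by
  constructor
  · intro Y
    have h1 := (h _ Y).mp rfl
    rw [← linearizedOp_graph, LinearPMap.mem_graph_iff] at h1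
    obtain ⟨X, hX1, hX2⟩ := h1
    dsimp only at hX1 hX2
    have hd : R Y ∈ (linearizedOp m ρ v w).domain := hX1 ▸ X.2
    refine ⟨hd, ?_⟩
    have : (⟨R Y, hd⟩ : (linearizedOp m ρ v w).domain) = X := Subtype.ext hX1.symm
    rw [this, hX2, add_sub_cancel_right]
  · intro X
    rw [h, sub_add_cancel, ← linearizedOp_graph]
    exact LinearPMap.mem_graph _ X

/-! ### Fourier multipliers on `L²` -/

theorem fourier_toDist (u : L2) : 𝓕 (toDist u) = toDist (𝓕 u) :=
  Lp.fourier_toTemperedDistribution_eq u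

/-- Multiplication by a function of temperate growth may leave `L²`, but two distributions
arising in this way agree only if the locally integrable functions representing them do. -/
theorem smulLeftCLM_toDist_eq_iff {p : R3 → ℂ} (hp : p.HasTemperateGrowth) (u g : L2) :
    smulLeftCLM ℂ p (toDist u) = toDist g ↔ ∀ᵐ k, p k * u k = g k := by
  have happ : ∀ φ : 𝓢(R3, ℂ), smulLeftCLM ℂ p (toDist u) φ = ∫ k, φ k • (p k * u k) := by
    intro φ
    refine (Lp.toTemperedDistribution_apply (μ := (volume : Measure R3)) u _).trans ?_
    refine integral_congr_ae (ae_of_all _ fun k => ?_)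
    have h1 := SchwartzMap.smulLeftCLM_apply_apply (F := ℂ) hp φ k
    change SchwartzMap.smulLeftCLM ℂ p φ k * u k = φ k * (p k * u k)
    rw [h1, smul_eq_mul]
    ring
  have happ' : ∀ φ : 𝓢(R3, ℂ), toDist g φ = ∫ k, φ k • g k := fun φ =>
    Lp.toTemperedDistribution_apply (μ := (volume : Measure R3)) g _
  constructor
  · intro h
    have hu : LocallyIntegrable (u : R3 → ℂ) := (Lp.memLp u).locallyIntegrable (by norm_num)
    have hg : LocallyIntegrable (g : R3 → ℂ) := (Lp.memLp g).locallyIntegrable (by norm_num)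
    refine ae_eq_of_integral_contDiff_smul_eq (f := fun k => p k * u k) ?_ hg ?_
    · rw [← locallyIntegrableOn_univ] at hu ⊢
      exact hu.continuousOn_mul hp.1.continuous.continuousOn isOpen_univ.isLocallyClosed
    · intro φ hφ hφc
      have h1 : HasCompactSupport (Complex.ofRealCLM ∘ φ) := hφc.comp_left rfl
      have h2 : ContDiff ℝ (⊤ : ℕ∞) (Complex.ofRealCLM ∘ φ) := by fun_prop
      have h3 := congrArg (fun T : 𝓢'(R3, ℂ) => T (h1.toSchwartzMap h2)) h
      rw [happ, happ'] at h3
      simpa using h3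
  · intro h
    ext φ
    rw [happ, happ']
    refine integral_congr_ae ?_
    filter_upwards [h] with k hk
    rw [hk]

theorem fourierMultiplierCLM_toDist_eq_iff {p : R3 → ℂ} (hp : p.HasTemperateGrowth) (u g : L2) :
    fourierMultiplierCLM ℂ p (toDist u) = toDist g ↔ ∀ᵐ k, p k * (𝓕 u : L2) k = (𝓕 g : L2) k := by
  rw [← smulLeftCLM_toDist_eq_iff hp, ← fourier_toDist, ← fourier_toDist,
    fourierMultiplierCLM_apply]
  constructor
  · intro h
    rw [← h, FourierTransform.fourier_fourierInv_eq]
  · intro h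
    rw [h, FourierTransform.fourierInv_fourier_eq]

theorem lineDerivOp_toDist_eq_iff (w : R3) (u g : L2) :
    ∂_{w} (toDist u) = toDist g ↔
      ∀ᵐ k, (2 * Real.pi * Complex.I * (inner ℝ k w : ℝ)) * (𝓕 u : L2) k = (𝓕 g : L2) k := by
  rw [← fourierMultiplierCLM_toDist_eq_iff (by fun_prop), lineDeriv_eq_fourierMultiplierCLM,
    ← _root_.smul_apply, ← fourierMultiplierCLM_smul (by fun_prop)]
  rfl

/-- An equation whose symbol is bounded below by a multiple of `1 + |k|²` is solvable in `H²`. -/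
theorem exists_fourierMultiplierCLM_eq {p : R3 → ℂ} (hp : p.HasTemperateGrowth) {c : ℝ}
    (hc : 0 < c) (hpc : ∀ k, c * (1 + ‖k‖ ^ 2) ≤ ‖p k‖) (g : L2) :
    ∃ u : H1, MemSobolev 2 2 (toDist (H1.fn u)) ∧
      fourierMultiplierCLM ℂ p (toDist (H1.fn u)) = toDist g := by
  have hp0 : ∀ k, p k ≠ 0 := fun k hk => by
    have := hpc k
    rw [hk, norm_zero] at this
    have : 0 < c * (1 + ‖k‖ ^ 2) := by positivity
    linarith
  have hmeas : AEStronglyMeasurable (fun k => (p k)⁻¹ * (𝓕 g : L2) k) volume :=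
    (hp.1.continuous.inv₀ hp0).aestronglyMeasurable.mul (Lp.aestronglyMeasurable _)
  have hbound : ∀ k, (1 + ‖k‖ ^ 2) * ‖(p k)⁻¹‖ ≤ c⁻¹ := fun k => by
    rw [norm_inv, ← div_eq_mul_inv, div_le_iff₀ (norm_pos_iff.mpr (hp0 k)),
      inv_mul_eq_div, le_div_iff₀ hc, mul_comm]
    exact hpc k
  have hmem2 : MemLp (fun k => ((1 + ‖k‖ ^ 2 : ℝ) : ℂ) * ((p k)⁻¹ * (𝓕 g : L2) k)) 2 volume := by
    refine (Lp.memLp (𝓕 g : L2)).of_le_mul (c := c⁻¹) ?_ (ae_of_all _ fun k => ?_)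
    · exact (Continuous.aestronglyMeasurable (by fun_prop)).mul hmeas
    · rw [norm_mul, norm_mul, ← mul_assoc, Complex.norm_of_nonneg (by positivity)]
      exact mul_le_mul_of_nonneg_right (hbound k) (norm_nonneg _)
  have hmem1 : MemLp (fun k => (p k)⁻¹ * (𝓕 g : L2) k) 2 volume := by
    refine hmem2.of_le hmeas (ae_of_all _ fun k => ?_)
    rw [norm_mul (((1 + ‖k‖ ^ 2 : ℝ) : ℂ)), Complex.norm_of_nonneg (by positivity)]
    exact le_mul_of_one_le_left (norm_nonneg _) (by nlinarith [sq_nonneg ‖k‖])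
  set u : L2 := 𝓕⁻ (hmem1.toLp _) with hu
  set f : L2 := 𝓕⁻ (hmem2.toLp _) with hf
  have hu' : (𝓕 u : L2) = hmem1.toLp _ := FourierTransform.fourier_fourierInv_eq _
  have hf' : (𝓕 f : L2) = hmem2.toLp _ := FourierTransform.fourier_fourierInv_eq _
  have hS : MemSobolev 2 2 (toDist u) := by
    refine ⟨f, (fourierMultiplierCLM_toDist_eq_iff (by fun_prop) u f).mpr ?_⟩
    rw [hu', hf']
    filter_upwards [hmem1.coeFn_toLp, hmem2.coeFn_toLp] with k h1 h2
    rw [h1, h2]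
    norm_num
  have hgrad : ∀ j, ∃ d : L2, ∂_{e j} (toDist u) = toDist d := fun j =>
    memSobolev_zero_iff.mp ((hS.lineDerivOp (m := e j)).mono (by norm_num))
  choose d hd using hgrad
  obtain ⟨U, hU, -⟩ := H1.exists_of_lineDeriv u d hd
  refine ⟨U, hU ▸ hS, ?_⟩
  rw [hU, fourierMultiplierCLM_toDist_eq_iff hp, hu']
  filter_upwards [hmem1.coeFn_toLp] with k h1
  rw [h1, mul_inv_cancel_left₀ (hp0 k)]

/-! ### The Klein-Gordon operator in the moving frame -/

theorem fourierMultiplierCLM_add {p q : R3 → ℂ} (hp : p.HasTemperateGrowth)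
    (hq : q.HasTemperateGrowth) (T : 𝓢'(R3, ℂ)) :
    fourierMultiplierCLM ℂ (p + q) T = fourierMultiplierCLM ℂ p T + fourierMultiplierCLM ℂ q T := by
  simp only [fourierMultiplierCLM_apply, smulLeftCLM_add hp hq, _root_.add_apply,
    FourierTransform.fourierInv_add]

/-- The symbol `2πi k·w` of the directional derivative `∂_w`. -/
def derivSymbol (w k : R3) : ℂ := 2 * Real.pi * Complex.I * (inner ℝ k w : ℝ)

@[fun_prop]
theorem hasTemperateGrowth_derivSymbol (w : R3) : (derivSymbol w).HasTemperateGrowth := by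
  unfold derivSymbol
  fun_prop

theorem fourierMultiplierCLM_derivSymbol (w : R3) (T : 𝓢'(R3, ℂ)) :
    fourierMultiplierCLM ℂ (derivSymbol w) T = ∂_{w} T := by
  rw [lineDeriv_eq_fourierMultiplierCLM, ← _root_.smul_apply,
    ← fourierMultiplierCLM_smul (by fun_prop)]
  rfl

theorem fourierMultiplierCLM_normSq (c : ℂ) (T : 𝓢'(R3, ℂ)) :
    fourierMultiplierCLM ℂ (fun k : R3 => c * (‖k‖ ^ 2 : ℝ)) T
      = (-(c / (2 * Real.pi) ^ 2)) • Δ T := by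
  have hpi : (Real.pi : ℂ) ≠ 0 := by exact_mod_cast Real.pi_ne_zero
  have h : fourierMultiplierCLM ℂ (fun k : R3 => c * (‖k‖ ^ 2 : ℝ)) T
      = c • fourierMultiplierCLM ℂ (fun k : R3 => ((‖k‖ ^ 2 : ℝ) : ℂ)) T := by
    rw [← _root_.smul_apply, ← fourierMultiplierCLM_smul (by fun_prop)]
    rfl
  rw [h, laplacian_eq_fourierMultiplierCLM, ← Complex.coe_smul, smul_smul]
  congr 1
  push_cast
  field_simp

/-- The symbol `m² + |2πk|² + (z - 2πi k·v)²` of `-Δ + m² + (z - v·∇)²`. -/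
def kgSymbol (m : ℝ) (v : R3) (z : ℂ) (k : R3) : ℂ :=
  (m : ℂ) ^ 2 + (2 * Real.pi) ^ 2 * (‖k‖ ^ 2 : ℝ) + (z - derivSymbol v k) ^ 2

@[fun_prop]
theorem hasTemperateGrowth_kgSymbol (m : ℝ) (v : R3) (z : ℂ) :
    (kgSymbol m v z).HasTemperateGrowth := by
  unfold kgSymbol
  fun_prop

/-- The operator `-Δ + m² + (z - v·∇)²` on tempered distributions; for `z = 0` it is the operator
of the soliton field equation. -/
def kgOp (m : ℝ) (v : R3) (z : ℂ) : 𝓢'(R3, ℂ) →L[ℂ] 𝓢'(R3, ℂ) :=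
  fourierMultiplierCLM ℂ (kgSymbol m v z)

theorem kgOp_apply (m : ℝ) (v : R3) (z : ℂ) (T : 𝓢'(R3, ℂ)) :
    kgOp m v z T = -Δ T + (m : ℂ) ^ 2 • T + (z ^ 2 • T - (2 * z) • ∂_{v} T + ∂_{v} (∂_{v} T)) := by
  have hpi : (Real.pi : ℂ) ≠ 0 := by exact_mod_cast Real.pi_ne_zero
  have hsplit : kgSymbol m v z = (fun k : R3 => (2 * Real.pi : ℂ) ^ 2 * (‖k‖ ^ 2 : ℝ))
      + ((fun _ : R3 => (m : ℂ) ^ 2 + z ^ 2) + ((-(2 * z)) • derivSymbol v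
      + derivSymbol v * derivSymbol v)) := by
    ext k
    simp only [kgSymbol, Pi.add_apply, Pi.mul_apply, Pi.smul_apply, smul_eq_mul]
    ring
  have hsq : fourierMultiplierCLM ℂ (derivSymbol v * derivSymbol v) T = ∂_{v} (∂_{v} T) := by
    rw [← fourierMultiplierCLM_fourierMultiplierCLM_apply (by fun_prop) (by fun_prop),
      fourierMultiplierCLM_derivSymbol, fourierMultiplierCLM_derivSymbol]
  rw [kgOp, hsplit, fourierMultiplierCLM_add (by fun_prop) (by fun_prop),
    fourierMultiplierCLM_add (by fun_prop) (by fun_prop),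
    fourierMultiplierCLM_add (by fun_prop) (by fun_prop), fourierMultiplierCLM_normSq,
    fourierMultiplierCLM_const, fourierMultiplierCLM_smul (by fun_prop), hsq,
    _root_.smul_apply, _root_.smul_apply, fourierMultiplierCLM_derivSymbol,
    div_self (pow_ne_zero 2 (mul_ne_zero two_ne_zero hpi))]
  simp only [ContinuousLinearMap.id_apply]
  module

theorem kgOp_toDist_eq_iff (m : ℝ) (v : R3) (z : ℂ) (u g : L2) :
    kgOp m v z (toDist u) = toDist g ↔
      ∀ᵐ k, kgSymbol m v z k * (𝓕 u : L2) k = (𝓕 g : L2) k :=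
  fourierMultiplierCLM_toDist_eq_iff (by fun_prop) u g

theorem kgSymbol_zero (m : ℝ) (v k : R3) :
    kgSymbol m v 0 k
      = ((m ^ 2 + (2 * Real.pi) ^ 2 * ‖k‖ ^ 2 - (2 * Real.pi * inner ℝ k v) ^ 2 : ℝ) : ℂ) := by
  rw [kgSymbol, derivSymbol]
  push_cast
  linear_combination (2 * Real.pi * (inner ℝ k v : ℝ) : ℂ) ^ 2 * Complex.I_sq

theorem kgSymbol_eq_add (m : ℝ) (v : R3) (z : ℂ) (k : R3) :
    kgSymbol m v z k = kgSymbol m v 0 k + z * (z - 2 * derivSymbol v k) := by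
  simp only [kgSymbol]
  ring

theorem sq_inner_le {v : R3} (k : R3) (m : ℝ) :
    (2 * Real.pi * inner ℝ k v) ^ 2 ≤ ‖v‖ ^ 2 * (m ^ 2 + (2 * Real.pi) ^ 2 * ‖k‖ ^ 2) := by
  have h1 : (inner ℝ k v : ℝ) ^ 2 ≤ ‖k‖ ^ 2 * ‖v‖ ^ 2 := by
    rw [← mul_pow, ← sq_abs]
    exact pow_le_pow_left₀ (abs_nonneg _) (abs_real_inner_le_norm k v) 2
  have h2 : 0 ≤ ‖v‖ ^ 2 * m ^ 2 := by positivity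
  calc (2 * Real.pi * inner ℝ k v) ^ 2 = (2 * Real.pi) ^ 2 * (inner ℝ k v : ℝ) ^ 2 := by ring
    _ ≤ (2 * Real.pi) ^ 2 * (‖k‖ ^ 2 * ‖v‖ ^ 2) := by gcongr
    _ ≤ _ := by linarith

theorem min_mul_le (m : ℝ) (k : R3) :
    min (m ^ 2) 1 * (1 + ‖k‖ ^ 2) ≤ m ^ 2 + (2 * Real.pi) ^ 2 * ‖k‖ ^ 2 := by
  have h1 : min (m ^ 2) 1 ≤ (2 * Real.pi) ^ 2 :=
    (min_le_right _ _).trans (by nlinarith [Real.pi_gt_three])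
  have h2 := mul_le_mul_of_nonneg_right h1 (sq_nonneg ‖k‖)
  linarith [min_le_left (m ^ 2) 1]

theorem exists_le_norm_kgSymbol_zero {m : ℝ} (hm : 0 < m) {v : R3} (hv : ‖v‖ < 1) :
    ∃ c : ℝ, 0 < c ∧ ∀ k, c * (1 + ‖k‖ ^ 2) ≤
      m ^ 2 + (2 * Real.pi) ^ 2 * ‖k‖ ^ 2 - (2 * Real.pi * inner ℝ k v) ^ 2 := by
  have hv2 : 0 < 1 - ‖v‖ ^ 2 := by nlinarith [norm_nonneg v]
  refine ⟨(1 - ‖v‖ ^ 2) * min (m ^ 2) 1, mul_pos hv2 (lt_min (by positivity) one_pos),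
    fun k => ?_⟩
  have h1 := mul_le_mul_of_nonneg_left (min_mul_le m k) hv2.le
  linarith [sq_inner_le (v := v) k m]

/-- The lower bounds `Re z` and `b - |Im z|` for `|z + iτ|`, averaged with the weights `|Im z|` and
`Re z`, give a positive multiple of `b`. -/
theorem le_norm_add_mul_I {z : ℂ} (hz : 0 < z.re) {b τ : ℝ} (hb : b ≤ |τ|) :
    z.re / (z.re + |z.im|) * b ≤ ‖z + τ * Complex.I‖ := by
  have h1 : z.re ≤ ‖z + τ * Complex.I‖ := by
    simpa using Complex.re_le_norm (z + τ * Complex.I)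
  have h2 : |τ| - |z.im| ≤ ‖z + τ * Complex.I‖ := by
    have h3 := Complex.abs_im_le_norm (z + τ * Complex.I)
    have h4 : (z + τ * Complex.I).im = τ - (-z.im) := by simp; ring
    rw [h4] at h3
    have := abs_sub_abs_le_abs_sub τ (-z.im)
    rw [abs_neg] at this
    linarith
  rw [div_mul_eq_mul_div, div_le_iff₀ (by positivity)]
  have h5 := mul_le_mul_of_nonneg_left h1 (abs_nonneg z.im)
  have h6 := mul_le_mul_of_nonneg_left h2 hz.le
  have h7 := mul_le_mul_of_nonneg_left hb hz.le
  linarith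

/-- The symbol factorizes as `(z - i(2πk·v - ω)) (z - i(2πk·v + ω))` with
`ω = √(m² + |2πk|²)` and `|2πk·v| ≤ |v| ω`, so that both factors are bounded below by a multiple
of `ω`. -/
theorem exists_le_norm_kgSymbol {m : ℝ} (hm : 0 < m) {v : R3} (hv : ‖v‖ < 1) {z : ℂ}
    (hz : 0 < z.re) : ∃ c : ℝ, 0 < c ∧ ∀ k, c * (1 + ‖k‖ ^ 2) ≤ ‖kgSymbol m v z k‖ := by
  set a : ℝ := z.re / (z.re + |z.im|) with ha
  have ha0 : 0 < a := by positivity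
  refine ⟨(a * (1 - ‖v‖)) ^ 2 * min (m ^ 2) 1, ?_, fun k => ?_⟩
  · have : 0 < 1 - ‖v‖ := by linarith
    exact mul_pos (by positivity) (lt_min (by positivity) one_pos)
  set E : ℝ := m ^ 2 + (2 * Real.pi) ^ 2 * ‖k‖ ^ 2 with hE
  set ω : ℝ := Real.sqrt E with hω
  have hE0 : 0 ≤ E := by positivity
  have hω2 : ω ^ 2 = E := Real.sq_sqrt hE0
  have hω0 : 0 ≤ ω := Real.sqrt_nonneg _
  set s : ℝ := 2 * Real.pi * inner ℝ k v with hs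
  have hsω : |s| ≤ ‖v‖ * ω := by
    refine abs_le_of_sq_le_sq ?_ (by positivity)
    rw [mul_pow ‖v‖, hω2]
    exact sq_inner_le k m
  have hfac : kgSymbol m v z k
      = (z + ((ω - s : ℝ) : ℂ) * Complex.I) * (z + ((-ω - s : ℝ) : ℂ) * Complex.I) := by
    have h1 : ((ω : ℂ)) ^ 2 = (m : ℂ) ^ 2 + (2 * Real.pi) ^ 2 * (‖k‖ ^ 2 : ℝ) := by
      rw [← Complex.ofReal_pow, hω2, hE]
      push_cast
      ring
    have h2 : derivSymbol v k = s * Complex.I := by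
      rw [derivSymbol, hs]
      push_cast
      ring
    rw [kgSymbol, ← h1, h2]
    push_cast
    linear_combination (ω : ℂ) ^ 2 * Complex.I_sq
  have hb1 : (1 - ‖v‖) * ω ≤ |ω - s| := by
    refine le_trans ?_ (le_abs_self _)
    linarith [le_abs_self s]
  have hb2 : (1 - ‖v‖) * ω ≤ |-ω - s| := by
    refine le_trans ?_ (neg_le_abs _)
    linarith [neg_le_abs s]
  have hn : 0 ≤ a * ((1 - ‖v‖) * ω) := mul_nonneg ha0.le (mul_nonneg (by linarith) hω0)
  calc (a * (1 - ‖v‖)) ^ 2 * min (m ^ 2) 1 * (1 + ‖k‖ ^ 2)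
      ≤ (a * (1 - ‖v‖)) ^ 2 * E := by
        rw [mul_assoc]
        exact mul_le_mul_of_nonneg_left (min_mul_le m k) (sq_nonneg _)
    _ = (a * ((1 - ‖v‖) * ω)) * (a * ((1 - ‖v‖) * ω)) := by rw [← hω2]; ring
    _ ≤ _ := by
        rw [hfac, norm_mul]
        exact mul_le_mul (le_norm_add_mul_I hz hb1) (le_norm_add_mul_I hz hb2) hn (norm_nonneg _)

theorem kgSymbol_ne_zero {m : ℝ} (hm : 0 < m) {v : R3} (hv : ‖v‖ < 1) {z : ℂ} (hz : 0 < z.re)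
    (k : R3) : kgSymbol m v z k ≠ 0 := by
  obtain ⟨c, hc, h⟩ := exists_le_norm_kgSymbol hm hv hz
  exact norm_pos_iff.mp (lt_of_lt_of_le (by positivity) (h k))

theorem exists_kgOp_eq {m : ℝ} (hm : 0 < m) {v : R3} (hv : ‖v‖ < 1) {z : ℂ} (hz : 0 < z.re)
    (g : L2) : ∃ u : H1, MemSobolev 2 2 (toDist (H1.fn u)) ∧
      kgOp m v z (toDist (H1.fn u)) = toDist g := by
  obtain ⟨c, hc, h⟩ := exists_le_norm_kgSymbol hm hv hz
  exact exists_fourierMultiplierCLM_eq (by fun_prop) hc h g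

/-- The field equation of the soliton is solvable, so that `solitonField` is its solution. -/
theorem kgOp_solitonField {m : ℝ} (hm : 0 < m) {v : R3} (hv : ‖v‖ < 1) (ρ : ChargeDensity) :
    kgOp m v 0 (toDist (H1.fn (solitonField m ρ v))) = toDist (-ρ.toL2) := by
  have hiff : ∀ ψ : H1, IsSolitonField m ρ v ψ ↔
      kgOp m v 0 (toDist (H1.fn ψ)) = toDist (-ρ.toL2) := fun ψ => by
    have h0 : ((0 : ℂ) ^ 2 • toDist (H1.fn ψ) - (2 * (0 : ℂ)) • ∂_{v} (toDist (H1.fn ψ))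
        + ∂_{v} (∂_{v} (toDist (H1.fn ψ)))) = ∂_{v} (∂_{v} (toDist (H1.fn ψ))) := by module
    rw [IsSolitonField, kgOp_apply, map_neg, map_smul, h0]
  obtain ⟨c, hc, h⟩ := exists_le_norm_kgSymbol_zero hm hv
  obtain ⟨ψ, -, hψ⟩ := exists_fourierMultiplierCLM_eq (p := kgSymbol m v 0) (by fun_prop) hc
    (fun k => by
      rw [kgSymbol_zero, Complex.norm_real]
      exact (h k).trans (le_abs_self _)) (-ρ.toL2)
  have hex : ∃ ψ : H1, IsSolitonField m ρ v ψ := ⟨ψ, (hiff ψ).mpr hψ⟩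
  rw [← hiff, solitonField, dif_pos hex]
  exact hex.choose_spec

/-! ### Directional derivatives of Sobolev functions -/

/-- The weak directional derivative `w·∇u ∈ L²` of `u ∈ H¹`. -/
def H1.dir (w : R3) : H1 →ₗ[ℂ] L2 := ∑ j, (w j : ℂ) • H1.grad j

theorem H1.lineDerivOp_eq_dir (w : R3) (u : H1) :
    ∂_{w} (toDist (H1.fn u)) = toDist (H1.dir w u) := by
  have hw : w = ∑ j, w j • e j := by
    ext i
    fin_cases i <;> simp [e, Fin.sum_univ_three]
  have hL : ∂_{∑ j, w j • e j} (toDist (H1.fn u)) = ∑ j, w j • ∂_{e j} (toDist (H1.fn u)) := by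
    simp only [Fin.sum_univ_three, LineDeriv.lineDerivOp_left_add,
      LineDeriv.lineDerivOp_left_smul]
  conv_lhs => rw [hw]
  rw [hL, H1.dir, LinearMap.sum_apply, map_sum]
  refine Finset.sum_congr rfl fun j _ => ?_
  rw [H1.lineDeriv_fn, LinearMap.smul_apply, map_smul]
  exact (Complex.coe_smul (w j) (toDist (H1.grad j u))).symm

/-- The Sobolev space `H¹` of pairs `(u, ∇u)` is the Bessel potential space of order `1`: the
distribution `u - (2π)⁻² Δu` is a sum of derivatives of `L²` functions, hence of order `-1`. -/
theorem H1.memSobolev_one (u : H1) : MemSobolev 1 2 (toDist (H1.fn u)) := by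
  have h0 : ∀ f : L2, MemSobolev 0 2 (toDist f) := fun f => memSobolev_zero_iff.mpr ⟨f, rfl⟩
  have hΔ : MemSobolev (-1) 2 (Δ (toDist (H1.fn u))) := by
    have h1 : ∀ j : Fin 3, MemSobolev (-1) 2 (∂_{e j} (∂_{e j} (toDist (H1.fn u)))) := fun j => by
      rw [H1.lineDeriv_fn]
      simpa using (h0 (H1.grad j u)).lineDerivOp (m := e j)
    rw [laplacian_eq_sum (EuclideanSpace.basisFun (Fin 3) ℝ), Fin.sum_univ_three]
    simp only [EuclideanSpace.basisFun_apply]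
    exact ((h1 0).add (h1 1)).add (h1 2)
  have hB : besselPotential R3 ℂ 2 (toDist (H1.fn u))
      = toDist (H1.fn u) + (-(1 / (2 * Real.pi : ℂ) ^ 2)) • Δ (toDist (H1.fn u)) := by
    have hs : (fun k : R3 => (((1 + ‖k‖ ^ 2) ^ ((2 : ℝ) / 2) : ℝ) : ℂ))
        = (fun _ => (1 : ℂ)) + fun k => 1 * ((‖k‖ ^ 2 : ℝ) : ℂ) := by
      ext k
      simp
    rw [besselPotential, hs, fourierMultiplierCLM_add (by fun_prop) (by fun_prop),
      fourierMultiplierCLM_normSq, fourierMultiplierCLM_const]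
    simp
  have h2 : MemSobolev (-1) 2 (besselPotential R3 ℂ 2 (toDist (H1.fn u))) := by
    rw [hB]
    exact ((h0 _).mono (by norm_num)).add (hΔ.smul _)
  rw [memSobolev_besselPotential_iff] at h2
  norm_num at h2
  exact h2

/-! ### Elimination of the momentum field -/

theorem lineDerivOp_sub (w : R3) (S T : 𝓢'(R3, ℂ)) : ∂_{w} (S - T) = ∂_{w} S - ∂_{w} T := by
  rw [sub_eq_add_neg, LineDeriv.lineDerivOp_add, LineDeriv.lineDerivOp_neg, ← sub_eq_add_neg]

/-- Eliminating `Π = zΨ + F₁ - v·∇Ψ` turns the resolvent equation into a Klein-Gordon equation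
for `Ψ` coupled to the equations for `(Q, P)`. -/
theorem mem_linearizedGraph_iff (m : ℝ) (ρ : ChargeDensity) (v : R3) (z : ℂ) (X Y : Energy) :
    (X, Y + z • X) ∈ linearizedGraph m ρ v v ↔
      mom X = H1.fn (psi Y) + z • H1.fn (psi X) - H1.dir v (psi X) ∧
      kgOp m v z (toDist (H1.fn (psi X))) = toDist (directionalDeriv ρ (pos X) - mom Y
        - z • H1.fn (psi Y) + H1.dir v (psi Y)) ∧
      pos Y + z • pos X = velocityMap v (imp X) ∧
      imp Y + z • imp X = impRow m ρ v X := by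
  change (toDist (H1.fn (psi (Y + z • X))) = psiRow v X ∧
    toDist (mom (Y + z • X)) = momRow m ρ v X ∧ pos (Y + z • X) = velocityMap v (imp X) ∧
    imp (Y + z • X) = impRow m ρ v X) ↔ _
  simp only [map_add pos, map_add imp, map_smul pos, map_smul imp]
  have hrow1 : toDist (H1.fn (psi (Y + z • X))) = psiRow v X ↔
      mom X = H1.fn (psi Y) + z • H1.fn (psi X) - H1.dir v (psi X) := by
    change _ = toDist (mom X) + ∂_{v} (toDist (H1.fn (psi X))) ↔ _
    rw [H1.lineDerivOp_eq_dir, ← map_add, toDist_injective.eq_iff, eq_sub_iff_add_eq, eq_comm,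
      map_add, map_smul, map_add, map_smul]
  rw [hrow1]
  refine and_congr_right fun h1 => and_congr_left' ?_
  change _ = Δ (toDist (H1.fn (psi X))) - toDist ((m : ℂ) ^ 2 • H1.fn (psi X))
    + ∂_{v} (toDist (mom X)) + toDist (directionalDeriv ρ (pos X)) ↔ _
  have hd : ∂_{v} (toDist (mom X)) = toDist (H1.dir v (psi Y))
      + z • ∂_{v} (toDist (H1.fn (psi X))) - ∂_{v} (∂_{v} (toDist (H1.fn (psi X)))) := by
    rw [h1, map_sub toDist, map_add toDist, map_smul toDist, lineDerivOp_sub,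
      LineDeriv.lineDerivOp_add, LineDeriv.lineDerivOp_smul, H1.lineDerivOp_eq_dir v (psi Y),
      ← H1.lineDerivOp_eq_dir v (psi X)]
  have hm : toDist (mom X) = toDist (H1.fn (psi Y)) + z • toDist (H1.fn (psi X))
      - ∂_{v} (toDist (H1.fn (psi X))) := by
    rw [h1, map_sub toDist, map_add toDist, map_smul toDist, H1.lineDerivOp_eq_dir]
  have hl : toDist (mom (Y + z • X)) = toDist (mom Y) + z • toDist (mom X) := by
    rw [map_add mom, map_smul mom, map_add toDist, map_smul toDist]
  have hr : toDist (directionalDeriv ρ (pos X) - mom Y - z • H1.fn (psi Y) + H1.dir v (psi Y))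
      = toDist (directionalDeriv ρ (pos X)) - toDist (mom Y) - z • toDist (H1.fn (psi Y))
        + toDist (H1.dir v (psi Y)) := by
    rw [map_add toDist, map_sub toDist, map_sub toDist, map_smul toDist]
  have hs : toDist ((m : ℂ) ^ 2 • H1.fn (psi X)) = (m : ℂ) ^ 2 • toDist (H1.fn (psi X)) :=
    map_smul toDist _ _
  rw [hd]
  simp only [hl, hm, hs, hr, kgOp_apply]
  constructor <;> intro h <;> linear_combination (norm := module) (1 : ℂ) • h

/-! ### Positivity -/

theorem re_integral_nonpos {α : Type*} [MeasurableSpace α] {μ : Measure α} {f : α → ℂ}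
    (hf : Integrable f μ) (h : ∀ᵐ x ∂μ, (f x).re ≤ 0) : (∫ x, f x ∂μ).re ≤ 0 := by
  have h1 : ∫ x, (f x).re ∂μ = (∫ x, f x ∂μ).re := integral_re hf
  rw [← h1]
  exact integral_nonpos_of_ae h

/-- `z⁻¹ (D⁻¹ - d⁻¹) = -μ / (d D)`, and `μ / D` has a nonnegative real part since
`μ D̄ = d μ + z̄ |μ|²`. -/
theorem re_inv_mul_inv_sub_inv_nonpos {z μ : ℂ} {d : ℝ} (hz : 0 < z.re) (hμ : 0 ≤ μ.re)
    (hd : 0 < d) (hD : (d : ℂ) + z * μ ≠ 0) :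
    (z⁻¹ * (((d : ℂ) + z * μ)⁻¹ - (d : ℂ)⁻¹)).re ≤ 0 := by
  have hz0 : z ≠ 0 := fun h => by simp [h] at hz
  have hd0 : (d : ℂ) ≠ 0 := by exact_mod_cast hd.ne'
  have h1 : z⁻¹ * (((d : ℂ) + z * μ)⁻¹ - (d : ℂ)⁻¹)
      = ((-(d⁻¹ * (Complex.normSq ((d : ℂ) + z * μ))⁻¹) : ℝ) : ℂ)
        * (d * μ + starRingEnd ℂ z * (Complex.normSq μ : ℝ)) := by
    have h2 : ((d : ℂ) + z * μ)⁻¹ = (d + starRingEnd ℂ z * starRingEnd ℂ μ)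
        * ((Complex.normSq ((d : ℂ) + z * μ))⁻¹ : ℝ) := by
      rw [Complex.inv_def]
      simp
    have h3 : z⁻¹ * (((d : ℂ) + z * μ)⁻¹ - (d : ℂ)⁻¹)
        = -((d : ℂ)⁻¹ * (μ * ((d : ℂ) + z * μ)⁻¹)) := by
      field_simp
      ring
    rw [h3, h2, Complex.normSq_eq_conj_mul_self (z := μ)]
    push_cast
    ring
  rw [h1, Complex.re_ofReal_mul]
  refine mul_nonpos_of_nonpos_of_nonneg ?_ ?_
  · exact neg_nonpos.mpr
      (mul_nonneg (inv_nonneg.mpr hd.le) (inv_nonneg.mpr (Complex.normSq_nonneg _)))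
  · rw [Complex.add_re, Complex.re_ofReal_mul, mul_comm (starRingEnd ℂ z), Complex.re_ofReal_mul,
      Complex.conj_re]
    have := Complex.normSq_nonneg μ
    positivity

theorem inner_velocityMap_self (v : R3) (p : C3) :
    inner ℂ (velocityMap v p) p
      = ((Real.sqrt (1 - ‖v‖ ^ 2) * (‖p‖ ^ 2
        - ‖inner ℂ (WithLp.toLp 2 fun j => (v j : ℂ) : C3) p‖ ^ 2) : ℝ) : ℂ) := by
  set s := Real.sqrt (1 - ‖v‖ ^ 2)
  have hn : (‖p‖ : ℂ) ^ 2 = ∑ j, starRingEnd ℂ (p j) * p j := by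
    rw [← Complex.ofReal_pow, EuclideanSpace.norm_sq_eq p]
    push_cast
    simp only [Complex.conj_mul']
  push_cast
  rw [hn, ← Complex.conj_mul' (inner ℂ _ p)]
  simp only [velocityMap, PiLp.inner_apply, RCLike.inner_apply,
    Matrix.toLpLin_apply, Matrix.mulVec, dotProduct, Matrix.of_apply, Fin.sum_univ_three]
  simp [Fin.isValue]
  ring

theorem inner_velocityMap_pos {v : R3} (hv : ‖v‖ < 1) {p : C3} (hp : p ≠ 0) :
    ∃ β : ℝ, 0 < β ∧ inner ℂ (velocityMap v p) p = (β : ℂ) := by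
  refine ⟨_, ?_, inner_velocityMap_self v p⟩
  have hv2 : 0 < 1 - ‖v‖ ^ 2 := by nlinarith [norm_nonneg v]
  have hn : ‖(WithLp.toLp 2 fun j => (v j : ℂ) : C3)‖ = ‖v‖ := by
    simp [EuclideanSpace.norm_eq]
  have h1 := pow_le_pow_left₀ (norm_nonneg _)
    (norm_inner_le_norm (𝕜 := ℂ) (WithLp.toLp 2 fun j => (v j : ℂ) : C3) p) 2
  rw [hn, mul_pow] at h1
  have h2 : 0 < ‖p‖ ^ 2 := by positivity
  refine mul_pos (Real.sqrt_pos.mpr hv2) ?_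
  nlinarith

/-! ### Absence of eigenvalues in the right half-plane -/

theorem fourier_grad (u : H1) (j : Fin 3) :
    ∀ᵐ k, (𝓕 (H1.grad j u) : L2) k = derivSymbol (e j) k * (𝓕 (H1.fn u) : L2) k := by
  filter_upwards [(lineDerivOp_toDist_eq_iff (e j) _ _).mp (H1.lineDeriv_fn u j)] with k hk
  exact hk.symm

theorem fourier_partialDeriv (ρ : ChargeDensity) (j : Fin 3) :
    ∀ᵐ k, (𝓕 (ρ.partialDeriv j) : L2) k = derivSymbol (e j) k * (𝓕 ρ.toL2 : L2) k := by
  filter_upwards [(lineDerivOp_toDist_eq_iff (e j) _ _).mp (ρ.lineDeriv_toL2 j)] with k hk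
  exact hk.symm

theorem fourier_sum_smul (c : Fin 3 → ℂ) (f : Fin 3 → L2) :
    ∀ᵐ k, (𝓕 (∑ j, c j • f j) : L2) k = ∑ j, c j * (𝓕 (f j) : L2) k := by
  have h : (𝓕 (∑ j, c j • f j) : L2) = ∑ j, c j • (𝓕 (f j) : L2) := by
    simp only [Fin.sum_univ_three, FourierTransform.fourier_add, FourierTransform.fourier_smul]
  rw [h]
  simp only [Fin.sum_univ_three]
  filter_upwards [Lp.coeFn_add (c 0 • (𝓕 (f 0) : L2) + c 1 • (𝓕 (f 1) : L2)) (c 2 • 𝓕 (f 2)),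
    Lp.coeFn_add (c 0 • (𝓕 (f 0) : L2)) (c 1 • 𝓕 (f 1)), Lp.coeFn_smul (c 0) (𝓕 (f 0) : L2),
    Lp.coeFn_smul (c 1) (𝓕 (f 1) : L2), Lp.coeFn_smul (c 2) (𝓕 (f 2) : L2)] with k h1 h2 h3 h4 h5
  rw [h1, Pi.add_apply, h2, Pi.add_apply, h3, h4, h5]
  rfl

theorem conj_derivSymbol (w k : R3) : starRingEnd ℂ (derivSymbol w k) = -derivSymbol w k := by
  simp only [derivSymbol, map_mul, Complex.conj_ofReal, Complex.conj_I, map_ofNat]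
  ring

set_option maxHeartbeats 800000 in
/-- The equations for `Ψ` and `P` of an eigenvector force `Re ⟨Q, P⟩ ≤ 0`: with `g = Q·∇ρ`, the
product `⟨Q, P⟩` equals `∫ |ĝ|² z⁻¹ (1/D_z - 1/D_0)`. -/
theorem re_inner_nonpos {m : ℝ} (hm : 0 < m) {v : R3} (hv : ‖v‖ < 1) (ρ : ChargeDensity) {z : ℂ}
    (hz : 0 < z.re) (X : Energy)
    (hψ : kgOp m v z (toDist (H1.fn (psi X))) = toDist (directionalDeriv ρ (pos X)))
    (hP : z • imp X = impRow m ρ v X) : (inner ℂ (pos X) (imp X) : ℂ).re ≤ 0 := by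
  have hz0 : z ≠ 0 := fun h => by simp [h] at hz
  set q : C3 := pos X
  set ψ : H1 := solitonField m ρ v
  set w : L2 := ∑ i, starRingEnd ℂ (q i) • H1.grad i (psi X) with hw
  set r : L2 := ∑ j, starRingEnd ℂ (q j) • ρ.partialDeriv j with hr
  set s : L2 := ∑ i, starRingEnd ℂ (q i) • H1.grad i ψ with hs
  have hI : inner ℂ q (imp X) = z⁻¹ * (-inner ℂ (𝓕 ρ.toL2 : L2) (𝓕 w : L2)
      + inner ℂ (𝓕 r : L2) (𝓕 s : L2)) := by
    rw [eq_inv_mul_iff_mul_eq₀ hz0, ← inner_smul_right, hP, Lp.inner_fourier_eq,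
      Lp.inner_fourier_eq, hw, hr, hs, PiLp.inner_apply]
    change ∑ i, inner ℂ (q i) (-inner ℂ ρ.toL2 (H1.grad i (psi X))
      + ∑ j, inner ℂ (ρ.partialDeriv j) (H1.grad i ψ) * q j) = _
    simp only [Fin.sum_univ_three, inner_add_left, inner_add_right, inner_smul_left,
      inner_smul_right, RCLike.inner_apply, Complex.conj_conj]
    ring
  -- Both inner products are integrals over momentum space; the sign is checked pointwise.
  rw [hI, L2.inner_def, L2.inner_def, ← integral_neg,
    ← integral_add (f := fun k => -inner ℂ ((𝓕 ρ.toL2 : L2) k) ((𝓕 w : L2) k))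
      (L2.integrable_inner _ _).neg (L2.integrable_inner _ _), ← integral_const_mul]
  refine re_integral_nonpos (((L2.integrable_inner _ _).neg.add
    (L2.integrable_inner _ _)).const_mul _) ?_
  have hg : ∀ᵐ k, (𝓕 (directionalDeriv ρ q) : L2) k = ∑ j, q j * (𝓕 (ρ.partialDeriv j) : L2) k :=
    fourier_sum_smul (fun j => q j) ρ.partialDeriv
  have hmul := (kgOp_toDist_eq_iff m v z _ _).mp hψ
  have hmul0 := (kgOp_toDist_eq_iff m v 0 _ _).mp (kgOp_solitonField hm hv ρ)
  have hneg : (𝓕 (-ρ.toL2) : L2) = -𝓕 ρ.toL2 := by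
    rw [← neg_one_smul ℂ, FourierTransform.fourier_smul, neg_one_smul]
  rw [hneg] at hmul0
  filter_upwards [hg, hmul, hmul0, Lp.coeFn_neg (𝓕 ρ.toL2 : L2),
    fourier_sum_smul (fun j => starRingEnd ℂ (q j)) fun j => H1.grad j (psi X),
    fourier_sum_smul (fun j => starRingEnd ℂ (q j)) ρ.partialDeriv,
    fourier_sum_smul (fun j => starRingEnd ℂ (q j)) fun j => H1.grad j ψ,
    ae_all_iff.mpr (fourier_grad (psi X)), ae_all_iff.mpr (fourier_grad ψ),
    ae_all_iff.mpr (fourier_partialDeriv ρ)] with k h1 h2 h3 h4 h5 h6 h7 h8 h9 h10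
  set D := kgSymbol m v z k with hD
  set d : ℝ := m ^ 2 + (2 * Real.pi) ^ 2 * ‖k‖ ^ 2 - (2 * Real.pi * inner ℝ k v) ^ 2 with hd
  set μ : ℂ := z - 2 * derivSymbol v k with hμ
  have hDd : (d : ℂ) + z * μ = D := by rw [hD, kgSymbol_eq_add, kgSymbol_zero]
  have hD0 : D ≠ 0 := kgSymbol_ne_zero hm hv hz k
  have hdpos : 0 < d := by
    obtain ⟨c, hc, h⟩ := exists_le_norm_kgSymbol_zero hm hv
    exact lt_of_lt_of_le (by positivity) (h k)
  have hd0 : (d : ℂ) ≠ 0 := by exact_mod_cast hdpos.ne'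
  have hμre : 0 ≤ μ.re := by
    simp [hμ, derivSymbol, hz.le]
  have key := re_inv_mul_inv_sub_inv_nonpos hz hμre hdpos (hDd ▸ hD0)
  rw [hDd] at key
  rw [kgSymbol_zero, h4, ← hd] at h3
  set κ : Fin 3 → ℂ := fun j => derivSymbol (e j) k
  set P : ℂ := (𝓕 ρ.toL2 : L2) k
  set a : ℂ := ∑ j, q j * κ j with ha
  -- `∂_j` has a purely imaginary symbol, so `Q̄·∇` has the symbol `-ā` if `Q·∇` has the symbol `a`.
  have hκc : ∀ j, starRingEnd ℂ (κ j) = -κ j := fun j => conj_derivSymbol _ _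
  have hac : starRingEnd ℂ a = -∑ j, starRingEnd ℂ (q j) * κ j := by
    simp only [ha, map_sum, map_mul, hκc, mul_neg, Finset.sum_neg_distrib]
  have hu : (𝓕 (H1.fn (psi X)) : L2) k = D⁻¹ * (a * P) := by
    rw [eq_inv_mul_iff_mul_eq₀ hD0, h2, h1, ha, Finset.sum_mul]
    simp only [h10]
    exact Finset.sum_congr rfl fun j _ => (mul_assoc _ _ _).symm
  have hv0 : (𝓕 (H1.fn ψ) : L2) k = -((d : ℂ)⁻¹ * P) := by
    rw [← mul_neg, eq_inv_mul_iff_mul_eq₀ hd0, h3]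
    rfl
  have hwk : (𝓕 w : L2) k = -(starRingEnd ℂ a * (D⁻¹ * (a * P))) := by
    rw [h5, hac, ← hu, neg_mul, neg_neg, Finset.sum_mul]
    simp only [h8]
    exact Finset.sum_congr rfl fun j _ => (mul_assoc _ _ _).symm
  have hrk : (𝓕 r : L2) k = -(starRingEnd ℂ a * P) := by
    rw [h6, hac, neg_mul, neg_neg, Finset.sum_mul]
    simp only [h10]
    exact Finset.sum_congr rfl fun j _ => (mul_assoc _ _ _).symm
  have hsk : (𝓕 s : L2) k = starRingEnd ℂ a * ((d : ℂ)⁻¹ * P) := by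
    have : (𝓕 s : L2) k = -(starRingEnd ℂ a * (𝓕 (H1.fn ψ) : L2) k) := by
      rw [h7, hac, neg_mul, neg_neg, Finset.sum_mul]
      simp only [h9]
      exact Finset.sum_congr rfl fun j _ => (mul_assoc _ _ _).symm
    rw [this, hv0]
    ring
  have hval : z⁻¹ * (-inner ℂ P ((𝓕 w : L2) k) + inner ℂ ((𝓕 r : L2) k) ((𝓕 s : L2) k))
      = ((Complex.normSq (a * P) : ℝ) : ℂ) * (z⁻¹ * (D⁻¹ - (d : ℂ)⁻¹)) := by
    rw [hwk, hrk, hsk, Complex.normSq_eq_conj_mul_self]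
    simp only [RCLike.inner_apply, map_neg, map_mul, Complex.conj_conj]
    ring
  rw [hval, Complex.re_ofReal_mul]
  exact mul_nonpos_of_nonneg_of_nonpos (Complex.normSq_nonneg _) key

/-- There are no eigenvalues in the right half-plane: the equation `z Q = B_v P` makes
`Re ⟨Q, P⟩` positive unless `P = 0`, against `re_inner_nonpos`. -/
theorem eq_zero_of_mem_linearizedGraph {m : ℝ} (hm : 0 < m) {v : R3} (hv : ‖v‖ < 1)
    (ρ : ChargeDensity) {z : ℂ} (hz : 0 < z.re) (X : Energy)
    (h : (X, z • X) ∈ linearizedGraph m ρ v v) : X = 0 := by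
  have hz0 : z ≠ 0 := fun h => by simp [h] at hz
  have h' := (mem_linearizedGraph_iff m ρ v z X 0).mp (by rwa [zero_add])
  simp only [map_zero, zero_add, sub_zero, smul_zero, add_zero] at h'
  obtain ⟨h1, h2, h3, h4⟩ := h'
  have hre := re_inner_nonpos hm hv ρ hz X h2 h4
  have hp : imp X = 0 := by
    by_contra hp
    obtain ⟨β, hβ, hin⟩ := inner_velocityMap_pos hv hp
    rw [← h3, inner_smul_left, ← eq_inv_mul_iff_mul_eq₀ (by simpa using hz0)] at hin
    rw [hin, mul_comm, Complex.re_ofReal_mul, Complex.inv_re, Complex.conj_re,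
      Complex.normSq_conj] at hre
    have h5 : 0 < Complex.normSq z := Complex.normSq_pos.mpr hz0
    have h6 : 0 < β * (z.re / Complex.normSq z) := by positivity
    linarith
  have hq : pos X = 0 := by
    rw [hp, map_zero] at h3
    exact (smul_eq_zero.mp h3).resolve_left hz0
  have hψ : psi X = 0 := by
    rw [hq, map_zero, kgOp_toDist_eq_iff] at h2
    have h5 : (𝓕 (H1.fn (psi X)) : L2) = 0 := by
      rw [Lp.eq_zero_iff_ae_eq_zero]
      have h0 : (𝓕 (0 : L2) : L2) = 0 := (Lp.fourierTransformₗᵢ R3 ℂ).map_zero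
      rw [h0] at h2
      filter_upwards [h2, Lp.coeFn_zero ℂ 2 (volume : Measure R3)] with k hk hk0
      rw [hk0] at hk
      exact (mul_eq_zero.mp hk).resolve_left (kgSymbol_ne_zero hm hv hz k)
    refine H1.fn_injective ?_
    rw [map_zero, ← norm_eq_zero, ← Lp.norm_fourier_eq, h5, norm_zero]
  refine Energy.ext ?_ ?_ ?_ ?_
  · rw [hψ, map_zero]
  · rw [h1, hψ, map_zero, map_zero, map_zero, sub_zero, smul_zero]
  · rw [hq, map_zero]
  · rw [hp, map_zero]

/-! ### Solvability of the resolvent equation -/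

/-- With `Ψ` expressed through `Q` and the data, the resolvent equation becomes a square linear
system for `(Q, P)`, whose injectivity is the absence of eigenvalues. -/
theorem exists_mem_linearizedGraph {m : ℝ} (hm : 0 < m) {v : R3} (hv : ‖v‖ < 1)
    (ρ : ChargeDensity) {z : ℂ} (hz : 0 < z.re) (Y : Energy) :
    ∃ X, (X, Y + z • X) ∈ linearizedGraph m ρ v v ∧ X ∈ EnergyPlus := by
  choose u huS hu using fun j => exists_kgOp_eq hm hv hz (ρ.partialDeriv j)
  obtain ⟨u₀, hu₀S, hu₀⟩ := exists_kgOp_eq hm hv hz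
    (-mom Y - z • H1.fn (psi Y) + H1.dir v (psi Y))
  -- `U q` is the field generated by the source `q·∇ρ`.
  let U : C3 →ₗ[ℂ] H1 :=
    { toFun := fun q => ∑ j, q j • u j
      map_add' := fun p q => by simp only [PiLp.add_apply, add_smul, Finset.sum_add_distrib]
      map_smul' := fun c q => by
        simp only [PiLp.smul_apply, smul_assoc, Finset.smul_sum, RingHom.id_apply] }
  have hU : ∀ q, kgOp m v z (toDist (H1.fn (U q))) = toDist (directionalDeriv ρ q) := fun q => by
    change kgOp m v z (toDist (H1.fn (∑ j, q j • u j))) = toDist (∑ j, q j • ρ.partialDeriv j)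
    simp only [map_sum, map_smul, hu]
  have hUS : ∀ q, MemSobolev 2 2 (toDist (H1.fn (U q))) := fun q => by
    change MemSobolev 2 2 (toDist (H1.fn (∑ j, q j • u j)))
    simp only [Fin.sum_univ_three, map_add, map_smul]
    exact (((huS 0).smul _).add ((huS 1).smul _)).add ((huS 2).smul _)
  let S : C3 →ₗ[ℂ] Energy :=
    { toFun := fun q => state (U q) 0 q 0
      map_add' := fun p q => Energy.ext (map_add U p q) (add_zero 0).symm rfl (add_zero 0).symm
      map_smul' := fun c q =>
        Energy.ext (map_smul U c q) (smul_zero c).symm rfl (smul_zero c).symm }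
  -- The matrix of the system for `(Q, P)`.
  let T : C3 × C3 →ₗ[ℂ] C3 × C3 :=
    (z • LinearMap.fst ℂ C3 C3 - velocityMap v ∘ₗ LinearMap.snd ℂ C3 C3).prod
      (z • LinearMap.snd ℂ C3 C3 - impRow m ρ v ∘ₗ S ∘ₗ LinearMap.fst ℂ C3 C3)
  have hT : ∀ q p, T (q, p) = (z • q - velocityMap v p, z • p - impRow m ρ v (S q)) :=
    fun _ _ => rfl
  have hTinj : Function.Injective T := by
    rw [← LinearMap.ker_eq_bot, LinearMap.ker_eq_bot']
    rintro ⟨q, p⟩ h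
    rw [hT, Prod.mk_eq_zero, sub_eq_zero, sub_eq_zero] at h
    have h0 := eq_zero_of_mem_linearizedGraph hm hv ρ hz
      (state (U q) (z • H1.fn (U q) - H1.dir v (U q)) q p) (by
        rw [← zero_add (z • state _ _ _ _), mem_linearizedGraph_iff]
        simp only [map_zero, zero_add, sub_zero, smul_zero, add_zero]
        exact ⟨rfl, hU q, h.1, h.2⟩)
    exact Prod.ext (congrArg pos h0) (congrArg imp h0)
  obtain ⟨⟨q, p⟩, hqp⟩ := (LinearMap.injective_iff_surjective.mp hTinj)
    (-pos Y, -imp Y + impRow m ρ v (state u₀ 0 0 0))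
  rw [hT, Prod.mk.injEq] at hqp
  refine ⟨state (U q + u₀) (H1.fn (psi Y) + z • H1.fn (U q + u₀) - H1.dir v (U q + u₀)) q p,
    (mem_linearizedGraph_iff m ρ v z _ Y).mpr ⟨rfl, ?_, ?_, ?_⟩, ?_, ?_⟩
  · change kgOp m v z (toDist (H1.fn (U q + u₀))) = toDist (directionalDeriv ρ q - mom Y
        - z • H1.fn (psi Y) + H1.dir v (psi Y))
    rw [map_add, map_add, map_add, hU, hu₀, ← map_add]
    congr 1
    abel
  · change pos Y + z • q = velocityMap v p
    linear_combination (norm := module) (1 : ℂ) • hqp.1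
  · change imp Y + z • p = impRow m ρ v (state (U q + u₀) 0 q 0)
    have hsum : state (U q + u₀) 0 q 0 = S q + state u₀ 0 0 0 :=
      Energy.ext rfl (add_zero 0).symm (add_zero q).symm (add_zero 0).symm
    rw [hsum, map_add]
    linear_combination (norm := module) (1 : ℂ) • hqp.2
  · change MemSobolev 2 2 (toDist (H1.fn (U q + u₀)))
    rw [map_add, map_add]
    exact (hUS q).add hu₀S
  · have h2 : MemSobolev 2 2 (toDist (H1.fn (U q + u₀))) := by
      rw [map_add, map_add]
      exact (hUS q).add hu₀S
    change MemSobolev 1 2 (toDist (H1.fn (psi Y) + z • H1.fn (U q + u₀) - H1.dir v (U q + u₀)))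
    rw [map_sub, map_add, map_smul, ← H1.lineDerivOp_eq_dir]
    refine ((H1.memSobolev_one _).add ((h2.mono (by norm_num)).smul z)).sub ?_
    have h3 := h2.lineDerivOp (m := v)
    rwa [show (2 : ℝ) - 1 = 1 by norm_num] at h3

end KGParticle

end

theorem proposition14p1 (m : ℝ) (hm : 0 < m) (ρ : KGParticle.ChargeDensity)
    (v : KGParticle.R3) (hv : ‖v‖ < 1) :
    ∃ R : ℂ → (KGParticle.Energy →L[ℂ] KGParticle.Energy),
      (∀ z : ℂ, 0 < z.re →
        KGParticle.IsResolventAt (KGParticle.linearizedOp m ρ v v) z (R z) ∧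
        ∀ Y, R z Y ∈ KGParticle.EnergyPlus) ∧
      AnalyticOnNhd ℂ R {z : ℂ | 0 < z.re} := by
  have hex : ∀ z : ℂ, ∃ R : KGParticle.Energy →L[ℂ] KGParticle.Energy, 0 < z.re →
      ∀ X Y, R Y = X ↔ (X, Y + z • X) ∈ KGParticle.linearizedGraph m ρ v v := fun z => by
    by_cases hz : 0 < z.re
    · obtain ⟨R, hR⟩ := KGParticle.exists_continuous_inverse_of_isClosed _
        (KGParticle.isClosed_linearizedGraph m ρ v v) z
        (fun Y => (KGParticle.exists_mem_linearizedGraph hm hv ρ hz Y).imp fun _ h => h.1)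
        (KGParticle.eq_zero_of_mem_linearizedGraph hm hv ρ hz)
      exact ⟨R, fun _ => hR⟩
    · exact ⟨0, fun h => absurd h hz⟩
  choose R hR using hex
  refine ⟨R, fun z hz => ⟨KGParticle.isResolventAt_of_mem_graph (hR z hz), fun Y => ?_⟩, ?_⟩
  · obtain ⟨X, hX, hXplus⟩ := KGParticle.exists_mem_linearizedGraph hm hv ρ hz Y
    rwa [(hR z hz X Y).mpr hX]
  · refine KGParticle.analyticOnNhd_of_resolvent_identity R _
      (isOpen_lt continuous_const Complex.continuous_re) fun z hz w hw => ?_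
    ext1 Y
    refine (hR z hz _ _).mpr ?_
    have h1 := (hR w hw _ Y).mp rfl
    -- `A R(w) Y = Y + w R(w) Y`, rewritten as `(Y + (w - z) R(w) Y) + z R(w) Y`
    convert h1 using 2
    change Y + (w - z) • R w Y + z • R w Y = _
    module
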